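/- Let $n\ge 1$ and let $A\in\mathbb R^{n\times n}$, $B\in\mathbb R^{n\times p}$, $C\in\mathbb R^{m\times n}$, $D\in\mathbb R^{m\times p}$ be an observable and controllable linear system. Fix $T_1,T_2\ge 1$, put $T=T_1+T_2+1$, let $G=[D,\,CB,\,CAB,\dots,CA^{T-2}B]\in\mathbb R^{m\times Tp}$ be its Markov parameter matrix, and let $\hat G\in\mathbb R^{m\times Tp}$ be arbitrary. For a block matrix $X=[X_1,\dots,X_T]\in\mathbb R^{m\times Tp}$ with blocks $X_k\in\mathbb R^{m\times p}$, the *Ho-Kalman algorithm* of order $n$ and Hankel shape $(T_1,T_2+1)$ proceeds as follows. Let $H$ be the $T_1\times(T_2+1)$ block Hankel matrix with $(i,j)$ block $X_{i+j}$; let $H^-$ and $H^+$ be obtained from $H$ by deleting its last, respectively first, block column. Let $L$ be a best rank-$n$ approximation of $H^-$, obtained by setting all but the top $n$ singular values in a singular value decomposition of $H^-$ to zero. Take a singular value decomposition $L=U\Sigma V^*$ with $\Sigma\in\mathbb R^{n\times n}$, and put $O=U\Sigma^{1/2}$ and $Q=\Sigma^{1/2}V^*$. The output consists of the first $m$ rows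 of $O$ (the matrix $C$), the first $p$ columns of $Q$ (the matrix $B$), and $O^\dagger H^+Q^\dagger$ (the matrix $A$), where $\dagger$ is the Moore–Penrose inverse. Let $H^+,L,O,Q,\bar A,\bar B,\bar C$ be the matrices produced by a run of the algorithm on $G$, and $\hat H^+,\hat L,\hat O,\hat Q,\hat A,\hat B,\hat C$ those produced by a run on $\hat G$ (for any admissible choices of the singular value decompositions). Let $\|\cdot\|$ be the spectral norm, $\|\cdot\|_F$ the Frobenius norm, and $\sigma_{\min}(L)$ the $n$th largest singular value of $L$. Suppose $\sigma_{\min}(L)>0$ and $$\|L-\hat L\|\le \sigma_{\min}(L)/2 .$$ Then there is an orthogonal matrix $W\in\mathbb R^{n\times n}$ such that $$\|\bar C-\hat CW\|_F\le\|O-\hat OW\|_F\le\sqrt{5n\|L-\hat L\|},$$ $$\|\bar B-W^*\hat B\|_F\le\|Q-W^*\hat Q\|_F\le\sqrt{5n\|L-\hat L\|},$$ and $$\|\bar A-W^*\hat AW\|_F\le\frac{14\sqrt n}{\sigma_{\min}(L)}\left(\sqrt{\frac{\|L-\hat L\|}{\sigma_{\min}(L)}}\,\bigl(\|H^+\|+\|H^+-\hat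 H^+\|\bigr)+\|H^+-\hat H^+\|\right).$$ -/

import Mathlib

open scoped Matrix

noncomputable section

/-! ### Norms and singular values of real matrices -/

open scoped Matrix.Norms.L2Operator in
/-- The spectral norm `‖M‖` (largest singular value), i.e. the Euclidean operator norm. -/
def specNorm {ι κ : Type*} [Fintype ι] [Fintype κ] [DecidableEq κ]
    (M : Matrix ι κ ℝ) : ℝ :=
  ‖M‖

open scoped Matrix.Norms.Frobenius in
/-- The Frobenius norm `‖M‖_F`. -/
def frobNorm {ι κ : Type*} [Fintype ι] [Fintype κ] (M : Matrix ι κ ℝ) : ℝ :=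
  ‖M‖

/-- The `n`-th largest singular value (counted from `1`, with multiplicity) of `M`;
Mathlib's sequence of singular values is decreasing and indexed from `0`. -/
def nthSingularValue {ι κ : Type*} [Fintype ι] [DecidableEq ι] [Fintype κ] [DecidableEq κ]
    (n : ℕ) (M : Matrix ι κ ℝ) : ℝ :=
  (Matrix.toEuclideanLin M).singularValues (n - 1)

/-! ### Moore-Penrose inverse -/

/-- The four Penrose equations: `X` is the Moore-Penrose inverse of `M`. -/
structure IsMoorePenrose {ι κ : Type*} [Fintype ι] [Fintype κ]
    (M : Matrix ι κ ℝ) (X : Matrix κ ι ℝ) : Prop where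
  mul_mul_self : M * X * M = M
  self_mul_mul : X * M * X = X
  symm_left : (M * X)ᵀ = M * X
  symm_right : (X * M)ᵀ = X * M

theorem exists_isMoorePenrose {ι κ : Type*} [Fintype ι] [Fintype κ] (M : Matrix ι κ ℝ) :
    ∃ X, IsMoorePenrose M X := by
  classical
  have hS : (Mᵀ * M).IsHermitian := by
    simpa using Matrix.isHermitian_conjTranspose_mul_self M
  obtain ⟨U, d, hU, hSd⟩ : ∃ (U : Matrix κ κ ℝ) (d : κ → ℝ),
      Uᵀ * U = 1 ∧ Mᵀ * M = U * Matrix.diagonal d * Uᵀ := by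
    refine ⟨hS.eigenvectorUnitary, hS.eigenvalues, ?_, ?_⟩
    · have := Matrix.UnitaryGroup.star_mul_self hS.eigenvectorUnitary
      simpa [Matrix.star_eq_conjTranspose] using this
    · have := hS.spectral_theorem
      simpa [Matrix.star_eq_conjTranspose, Unitary.conjStarAlgAut_apply] using this
  set P := U * Matrix.diagonal (fun i => (d i)⁻¹) * Uᵀ with hP
  have hPt : Pᵀ = P := by simp [hP, Matrix.mul_assoc]
  have cancel : ∀ a b : κ → ℝ, (U * Matrix.diagonal a * Uᵀ) * (U * Matrix.diagonal b * Uᵀ)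
      = U * Matrix.diagonal (fun i => a i * b i) * Uᵀ := by
    intro a b
    calc _ = U * Matrix.diagonal a * (Uᵀ * U) * Matrix.diagonal b * Uᵀ := by
          simp only [Matrix.mul_assoc]
      _ = _ := by
          rw [hU, Matrix.mul_one, Matrix.mul_assoc U, Matrix.diagonal_mul_diagonal]
  have hSt : (Mᵀ * M)ᵀ = Mᵀ * M := by simp
  have hSPS : Mᵀ * M * P * (Mᵀ * M) = Mᵀ * M := by
    rw [hSd, hP, cancel, cancel]
    congr 3
    funext i
    by_cases h : d i = 0 <;> simp [h]
  have hPSP : P * (Mᵀ * M) * P = P := by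
    rw [hSd, hP, cancel, cancel]
    congr 3
    funext i
    by_cases h : d i = 0 <;> simp [h]
  have hcomm : Mᵀ * M * P = P * (Mᵀ * M) := by
    rw [hSd, hP, cancel, cancel]
    congr 3
    funext i
    ring
  have hM : M * (P * (Mᵀ * M)) = M := by
    have h0 : (M * (P * (Mᵀ * M)) - M)ᵀ * (M * (P * (Mᵀ * M)) - M) = 0 := by
      have h1 : Mᵀ * (M * (P * (Mᵀ * M)) - M) = 0 := by
        rw [Matrix.mul_sub, ← Matrix.mul_assoc, ← Matrix.mul_assoc, hSPS, sub_self]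
      have h2 : (M * (P * (Mᵀ * M)) - M) = M * (P * (Mᵀ * M) - 1) := by
        rw [Matrix.mul_sub, Matrix.mul_one]
      nth_rewrite 1 [h2]
      rw [Matrix.transpose_mul, Matrix.mul_assoc, h1, Matrix.mul_zero]
    rw [← Matrix.conjTranspose_eq_transpose_of_trivial] at h0
    exact sub_eq_zero.mp (Matrix.conjTranspose_mul_self_eq_zero.mp h0)
  refine ⟨P * Mᵀ, ⟨?_, ?_, ?_, ?_⟩⟩
  · simpa only [Matrix.mul_assoc] using hM
  · calc P * Mᵀ * M * (P * Mᵀ) = P * (Mᵀ * M) * P * Mᵀ := by simp only [Matrix.mul_assoc]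
      _ = _ := by rw [hPSP]
  · simp [hPt, Matrix.mul_assoc]
  · rw [Matrix.mul_assoc, Matrix.transpose_mul, hSt, hPt, hcomm]

theorem IsMoorePenrose.unique {ι κ : Type*} [Fintype ι] [Fintype κ]
    {M : Matrix ι κ ℝ} {X Y : Matrix κ ι ℝ}
    (hX : IsMoorePenrose M X) (hY : IsMoorePenrose M Y) : X = Y := by
  have h1 : M * X = M * Y := by
    calc M * X = (M * Y * M) * X := by rw [hY.mul_mul_self]
      _ = (M * Y)ᵀ * (M * X)ᵀ := by
          rw [hX.symm_left, hY.symm_left]; simp only [Matrix.mul_assoc]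
      _ = (M * X * M * Y)ᵀ := by
          rw [← Matrix.transpose_mul]; simp only [Matrix.mul_assoc]
      _ = M * Y := by rw [hX.mul_mul_self, hY.symm_left]
  have h2 : X * M = Y * M := by
    calc X * M = X * (M * Y * M) := by rw [hY.mul_mul_self]
      _ = (X * M)ᵀ * (Y * M)ᵀ := by
          rw [hX.symm_right, hY.symm_right]; simp only [Matrix.mul_assoc]
      _ = (Y * (M * X * M))ᵀ := by
          rw [← Matrix.transpose_mul]; simp only [Matrix.mul_assoc]
      _ = Y * M := by rw [hX.mul_mul_self, hY.symm_right]
  calc X = X * M * X := hX.self_mul_mul.symm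
    _ = Y * M * Y := by rw [h2, Matrix.mul_assoc, h1, Matrix.mul_assoc]
    _ = Y := hY.self_mul_mul

/-- The Moore-Penrose inverse `M†` (it exists and is unique). -/
def pinv {ι κ : Type*} [Fintype ι] [Fintype κ] (M : Matrix ι κ ℝ) : Matrix κ ι ℝ :=
  (exists_isMoorePenrose M).choose

theorem isMoorePenrose_pinv {ι κ : Type*} [Fintype ι] [Fintype κ] (M : Matrix ι κ ℝ) :
    IsMoorePenrose M (pinv M) :=
  (exists_isMoorePenrose M).choose_spec

/-! ### Singular value decompositions and truncation -/

/-- `M = U Σ V*` is a (compact) singular value decomposition with `r` singular values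
`s 0 ≥ s 1 ≥ ⋯ ≥ 0`, where `Σ = diag(s)` is `r × r` and `U`, `V` have orthonormal columns. -/
structure IsSVD {ι κ : Type*} [Fintype ι] [Fintype κ] {r : ℕ} (M : Matrix ι κ ℝ)
    (U : Matrix ι (Fin r) ℝ) (s : Fin r → ℝ) (V : Matrix κ (Fin r) ℝ) : Prop where
  left_orthonormal : Uᵀ * U = 1
  right_orthonormal : Vᵀ * V = 1
  nonneg : ∀ i, 0 ≤ s i
  antitone : Antitone s
  eq_mul : M = U * Matrix.diagonal s * Vᵀ

/-- `L` is a best rank-`n` approximation of `M`: it is obtained from a singular value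
decomposition of `M` by setting all but the top `n` singular values to zero. -/
def IsRankApprox {ι κ : Type*} [Fintype ι] [Fintype κ] (n : ℕ) (M L : Matrix ι κ ℝ) : Prop :=
  ∃ (r : ℕ) (U : Matrix ι (Fin r) ℝ) (s : Fin r → ℝ) (V : Matrix κ (Fin r) ℝ),
    IsSVD M U s V ∧
      L = U * Matrix.diagonal (fun i : Fin r => if (i : ℕ) < n then s i else 0) * Vᵀ

/-! ### Linear systems, Markov parameters and Hankel matrices

A block matrix with `T` blocks of size `p` along one side is indexed by `Fin T × Fin p`
(block index, index inside the block). -/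

/-- `(A, B)` is controllable: `[B, AB, …, A^(n-1) B]` has rank `n`. -/
def IsControllable {n p : ℕ} (A : Matrix (Fin n) (Fin n) ℝ) (B : Matrix (Fin n) (Fin p) ℝ) :
    Prop :=
  (Matrix.of fun (i : Fin n) (c : Fin n × Fin p) => (A ^ (c.1 : ℕ) * B) i c.2).rank = n

/-- `(C, A)` is observable: the stacked matrix of `C, CA, …, CA^(n-1)` has rank `n`. -/
def IsObservable {n m : ℕ} (C : Matrix (Fin m) (Fin n) ℝ) (A : Matrix (Fin n) (Fin n) ℝ) :
    Prop :=
  (Matrix.of fun (r : Fin n × Fin m) (j : Fin n) => (C * A ^ (r.1 : ℕ)) r.2 j).rank = n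

/-- The Markov parameter matrix `G = [D, CB, CAB, …, C A^(T-2) B]`. -/
def markovMatrix {n m p : ℕ} (T : ℕ) (A : Matrix (Fin n) (Fin n) ℝ)
    (B : Matrix (Fin n) (Fin p) ℝ) (C : Matrix (Fin m) (Fin n) ℝ)
    (D : Matrix (Fin m) (Fin p) ℝ) : Matrix (Fin m) (Fin T × Fin p) ℝ :=
  Matrix.of fun a c =>
    if (c.1 : ℕ) = 0 then D a c.2 else (C * A ^ ((c.1 : ℕ) - 1) * B) a c.2

/-- The clipped `(T₁, T₂)` Hankel matrix of `X = [X_1, …, X_T]`, whose `(i, j)` block is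
`X_{i+j}` with `i`, `j` and the blocks of `X` counted from `1`. Counted from `0`, as here,
the `(i, j)` block is block number `i + j + 1`. -/
def clippedHankel {m p T : ℕ} (T₁ T₂ : ℕ) (hT : T₁ + T₂ ≤ T)
    (X : Matrix (Fin m) (Fin T × Fin p) ℝ) : Matrix (Fin T₁ × Fin m) (Fin T₂ × Fin p) ℝ :=
  Matrix.of fun r c => X r.2 (⟨(r.1 : ℕ) + (c.1 : ℕ) + 1, by omega⟩, c.2)

/-! ### The Ho-Kalman algorithm -/

section HoKalman

variable {m p : ℕ}

/-- The `(T₁, T₂ + 1)` Hankel matrix `H` of `G`, where `G` has `T = T₁ + T₂ + 1` blocks. -/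
def hankelFull (T₁ T₂ : ℕ) (G : Matrix (Fin m) (Fin (T₁ + T₂ + 1) × Fin p) ℝ) :
    Matrix (Fin T₁ × Fin m) (Fin (T₂ + 1) × Fin p) ℝ :=
  clippedHankel T₁ (T₂ + 1) (by omega) G

/-- `H⁻`: the Hankel matrix without its last block column. -/
def hankelMinus (T₁ T₂ : ℕ) (G : Matrix (Fin m) (Fin (T₁ + T₂ + 1) × Fin p) ℝ) :
    Matrix (Fin T₁ × Fin m) (Fin T₂ × Fin p) ℝ :=
  (hankelFull T₁ T₂ G).submatrix id (Prod.map Fin.castSucc id)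

/-- `H⁺`: the Hankel matrix without its first block column. -/
def hankelPlus (T₁ T₂ : ℕ) (G : Matrix (Fin m) (Fin (T₁ + T₂ + 1) × Fin p) ℝ) :
    Matrix (Fin T₁ × Fin m) (Fin T₂ × Fin p) ℝ :=
  (hankelFull T₁ T₂ G).submatrix id (Prod.map Fin.succ id)

/-- A run of the Ho-Kalman algorithm of order `n` and Hankel shape `(T₁, T₂ + 1)` on the input
`G`. The fields record the choices that the algorithm leaves open (the rank-`n` approximation
`L` of `H⁻` when singular values coincide, and the singular value decomposition
`L = U Σ V*` with `Σ = diag(s)` of size `n × n`). -/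
structure HoKalmanRun (n T₁ T₂ : ℕ) (G : Matrix (Fin m) (Fin (T₁ + T₂ + 1) × Fin p) ℝ) where
  L : Matrix (Fin T₁ × Fin m) (Fin T₂ × Fin p) ℝ
  U : Matrix (Fin T₁ × Fin m) (Fin n) ℝ
  s : Fin n → ℝ
  V : Matrix (Fin T₂ × Fin p) (Fin n) ℝ
  isRankApprox : IsRankApprox n (hankelMinus T₁ T₂ G) L
  isSVD : IsSVD L U s V

namespace HoKalmanRun

variable {n T₁ T₂ : ℕ} {G : Matrix (Fin m) (Fin (T₁ + T₂ + 1) × Fin p) ℝ}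

/-- The observability factor `O = U Σ^{1/2}`. -/
def O (R : HoKalmanRun n T₁ T₂ G) : Matrix (Fin T₁ × Fin m) (Fin n) ℝ :=
  R.U * Matrix.diagonal fun i => √(R.s i)

/-- The controllability factor `Q = Σ^{1/2} V*`. -/
def Q (R : HoKalmanRun n T₁ T₂ G) : Matrix (Fin n) (Fin T₂ × Fin p) ℝ :=
  (Matrix.diagonal fun i => √(R.s i)) * R.Vᵀ

/-- The output `C`: the first `m` rows (the first block row) of `O`. -/
def C [NeZero T₁] (R : HoKalmanRun n T₁ T₂ G) : Matrix (Fin m) (Fin n) ℝ :=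
  R.O.submatrix (fun a => ((0 : Fin T₁), a)) id

/-- The output `B`: the first `p` columns (the first block column) of `Q`. -/
def B [NeZero T₂] (R : HoKalmanRun n T₁ T₂ G) : Matrix (Fin n) (Fin p) ℝ :=
  R.Q.submatrix id (fun b => ((0 : Fin T₂), b))

/-- The output `A = O† H⁺ Q†`. -/
def A (R : HoKalmanRun n T₁ T₂ G) : Matrix (Fin n) (Fin n) ℝ :=
  pinv R.O * hankelPlus T₁ T₂ G * pinv R.Q

end HoKalmanRun

end HoKalman

end

/-! Stack the two balanced factors into `Z = [O; Qᵀ]`, and likewise `Ẑ`. Both Gram blocks `OᵀO` and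
`QQᵀ` equal `Σ`, so `ZᵀZ = 2Σ ≥ 2σ`, where `σ = σ_min(L)`, and a single orthogonal `W` can align
both factors at once. Choose `W` by polar decomposition so that `ZᵀẐW` is positive semidefinite. The
Procrustes bound `mul_frobNorm_sub_sq_le` then controls `‖Z - ẐW‖_F` by `‖ZZᵀ - ẐẐᵀ‖_F`.
Balancedness bounds the latter by `2‖L - L̂‖_F` (`frobNorm_fromRows_mul_transpose_sub_sq_le`), and
`L - L̂` has rank at most `2n`, so its Frobenius norm is at most `√(2n)` times its spectral norm.
Together, with `δ = ‖L - L̂‖`, this gives `σ‖Z - ẐW‖_F² ≤ 5nδ²`, and `δ ≤ σ/2` turns one factor `δ`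
into `σ/2`.

For the state matrix, a min-max argument (`IsSVD.le_of_forall_mulVec`) shows that the singular
values of `L̂` are at least `σ/2`. The pseudo-inverses of all factors are therefore of size
`σ^(-1/2)`. Perturbation of pseudo-inverses (`frobNorm_leftInverse_sub_le`) and a telescoping
product (`frobNorm_mul_mul_sub_le`) give the last estimate. -/

/-! ### Frobenius and spectral norms; perturbation of left inverses. -/

section Norms

variable {ι κ μ : Type*} [Fintype ι] [Fintype κ] [Fintype μ]

theorem frobNorm_nonneg (M : Matrix ι κ ℝ) : 0 ≤ frobNorm M := by
  unfold frobNorm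
  exact @norm_nonneg _ Matrix.frobeniusSeminormedAddCommGroup.toSeminormedAddGroup M

theorem frobNorm_sq (M : Matrix ι κ ℝ) : frobNorm M ^ 2 = ∑ i, ∑ j, M i j ^ 2 := by
  rw [frobNorm, Matrix.frobenius_norm_def, ← Real.sqrt_eq_rpow, Real.sq_sqrt]
  · simp
  · positivity

theorem frobNorm_sq_eq_trace (M : Matrix ι κ ℝ) : frobNorm M ^ 2 = (Mᵀ * M).trace := by
  rw [frobNorm_sq, Finset.sum_comm]
  simp [Matrix.trace, Matrix.mul_apply, sq]

open scoped Matrix.Norms.Frobenius in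
theorem frobNorm_add_le (M N : Matrix ι κ ℝ) : frobNorm (M + N) ≤ frobNorm M + frobNorm N :=
  norm_add_le M N

open scoped Matrix.Norms.Frobenius in
theorem frobNorm_neg (M : Matrix ι κ ℝ) : frobNorm (-M) = frobNorm M :=
  norm_neg M

theorem frobNorm_transpose (M : Matrix ι κ ℝ) : frobNorm Mᵀ = frobNorm M :=
  Matrix.frobenius_norm_transpose M

theorem frobNorm_one {n : ℕ} : frobNorm (1 : Matrix (Fin n) (Fin n) ℝ) = √n := by
  refine (Real.sqrt_eq_iff_mul_self_eq (by positivity) (frobNorm_nonneg _)).2 ?_ |>.symm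
  rw [← sq, frobNorm_sq_eq_trace]
  simp

theorem frobNorm_of_transpose_mul_self_eq_one {n : ℕ} {V : Matrix ι (Fin n) ℝ}
    (hV : Vᵀ * V = 1) : frobNorm V = √n := by
  refine (Real.sqrt_eq_iff_mul_self_eq (by positivity) (frobNorm_nonneg _)).2 ?_ |>.symm
  rw [← sq, frobNorm_sq_eq_trace, hV]
  simp

theorem frobNorm_mul_of_transpose_mul_self_eq_one [DecidableEq κ] {V : Matrix ι κ ℝ}
    (hV : Vᵀ * V = 1) (N : Matrix κ μ ℝ) : frobNorm (V * N) = frobNorm N := by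
  rw [← sq_eq_sq₀ (frobNorm_nonneg _) (frobNorm_nonneg _), frobNorm_sq_eq_trace,
    frobNorm_sq_eq_trace, Matrix.transpose_mul, Matrix.mul_assoc, ← Matrix.mul_assoc Vᵀ, hV,
    Matrix.one_mul]

theorem frobNorm_submatrix_le {ι' κ' : Type*} [Fintype ι'] [Fintype κ'] (M : Matrix ι κ ℝ)
    {f : ι' → ι} {g : κ' → κ} (hf : f.Injective) (hg : g.Injective) :
    frobNorm (M.submatrix f g) ≤ frobNorm M := by
  rw [← sq_le_sq₀ (frobNorm_nonneg _) (frobNorm_nonneg _), frobNorm_sq, frobNorm_sq,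
    ← Fintype.sum_prod_type', ← Fintype.sum_prod_type']
  let e : ι' × κ' ↪ ι × κ := ⟨Prod.map f g, hf.prodMap hg⟩
  have := Finset.sum_le_univ_sum_of_nonneg (f := fun x : ι × κ => M x.1 x.2 ^ 2)
    (s := Finset.univ.map e) (fun x => sq_nonneg _)
  rwa [Finset.sum_map] at this

/-- Pythagoras for the rows of `M`, split by the orthogonal projection `P`. -/
theorem frobNorm_sq_add_of_isIdempotent [DecidableEq κ] (M : Matrix ι κ ℝ) {P : Matrix κ κ ℝ}
    (hP : P * P = P) (hPt : Pᵀ = P) :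
    frobNorm M ^ 2 = frobNorm (M * P) ^ 2 + frobNorm (M * (1 - P)) ^ 2 := by
  simp only [frobNorm_sq_eq_trace, Matrix.transpose_mul, Matrix.transpose_sub, hPt,
    Matrix.transpose_one]
  have h1 : (P * Mᵀ * (M * P)).trace = (Mᵀ * M * P).trace := by
    rw [Matrix.mul_assoc, Matrix.trace_mul_comm, Matrix.mul_assoc, Matrix.mul_assoc, hP,
      ← Matrix.mul_assoc]
  have h2 : ((1 - P) * Mᵀ * (M * (1 - P))).trace = (Mᵀ * M * (1 - P)).trace := by
    have : (1 - P) * (1 - P) = 1 - P := by simp [Matrix.mul_sub, Matrix.sub_mul, hP]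
    rw [Matrix.mul_assoc, Matrix.trace_mul_comm, Matrix.mul_assoc, Matrix.mul_assoc, this,
      ← Matrix.mul_assoc]
  rw [h1, h2, Matrix.mul_sub, Matrix.trace_sub, Matrix.mul_one]
  ring

theorem frobNorm_mul_one_sub_le [DecidableEq κ] (M : Matrix ι κ ℝ) {P : Matrix κ κ ℝ}
    (hP : P * P = P) (hPt : Pᵀ = P) : frobNorm (M * (1 - P)) ≤ frobNorm M := by
  rw [← sq_le_sq₀ (frobNorm_nonneg _) (frobNorm_nonneg _),
    frobNorm_sq_add_of_isIdempotent M hP hPt]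
  exact le_add_of_nonneg_left (sq_nonneg _)

open scoped Matrix.Norms.L2Operator in
theorem specNorm_nonneg [DecidableEq κ] (M : Matrix ι κ ℝ) : 0 ≤ specNorm M :=
  norm_nonneg M

open scoped Matrix.Norms.L2Operator in
theorem specNorm_transpose [DecidableEq ι] [DecidableEq κ] (M : Matrix ι κ ℝ) :
    specNorm Mᵀ = specNorm M := by
  rw [← Matrix.conjTranspose_eq_transpose_of_trivial]
  exact Matrix.l2_opNorm_conjTranspose M

open scoped Matrix.Norms.L2Operator in
theorem specNorm_mul_le [DecidableEq κ] [DecidableEq μ] (M : Matrix ι κ ℝ) (N : Matrix κ μ ℝ) :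
    specNorm (M * N) ≤ specNorm M * specNorm N :=
  Matrix.l2_opNorm_mul M N

open scoped Matrix.Norms.L2Operator in
theorem specNorm_le_add_specNorm_sub [DecidableEq κ] (M N : Matrix ι κ ℝ) :
    specNorm N ≤ specNorm M + specNorm (M - N) := by
  have := norm_sub_le M (M - N)
  rwa [sub_sub_cancel] at this

open scoped Matrix.Norms.L2Operator in
theorem specNorm_le_one_of_transpose_mul_self_eq_one [DecidableEq κ] {V : Matrix ι κ ℝ}
    (hV : Vᵀ * V = 1) : specNorm V ≤ 1 := by
  have h : specNorm V * specNorm V ≤ 1 := by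
    have h1 := Matrix.l2_opNorm_conjTranspose_mul_self V
    rw [Matrix.conjTranspose_eq_transpose_of_trivial, hV] at h1
    change ‖V‖ * ‖V‖ ≤ 1
    rw [← h1, ← Matrix.diagonal_one, Matrix.l2_opNorm_diagonal]
    exact (pi_norm_le_iff_of_nonneg zero_le_one).2 (by simp)
  nlinarith [specNorm_nonneg V]

open scoped Matrix.Norms.L2Operator in
theorem specNorm_diagonal_le [DecidableEq κ] {d : κ → ℝ} {c : ℝ} (hc : 0 ≤ c)
    (hd : ∀ i, |d i| ≤ c) : specNorm (Matrix.diagonal d) ≤ c := by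
  rw [specNorm, Matrix.l2_opNorm_diagonal]
  exact (pi_norm_le_iff_of_nonneg hc).2 hd

open scoped Matrix.Norms.L2Operator in
theorem dotProduct_mulVec_self_le [DecidableEq κ] (M : Matrix ι κ ℝ) (x : κ → ℝ) :
    M *ᵥ x ⬝ᵥ M *ᵥ x ≤ specNorm M ^ 2 * (x ⬝ᵥ x) := by
  have h := Matrix.l2_opNorm_mulVec M (WithLp.toLp 2 x)
  have h2 := pow_le_pow_left₀ (norm_nonneg _) h 2
  rw [mul_pow, EuclideanSpace.norm_sq_eq, EuclideanSpace.norm_sq_eq] at h2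
  simpa [dotProduct, sq, specNorm] using h2

theorem frobNorm_mul_le_left [DecidableEq κ] (M : Matrix ι κ ℝ) (N : Matrix κ μ ℝ) :
    frobNorm (M * N) ≤ specNorm M * frobNorm N := by
  rw [← sq_le_sq₀ (frobNorm_nonneg _) (mul_nonneg (specNorm_nonneg _) (frobNorm_nonneg _)),
    mul_pow, frobNorm_sq, frobNorm_sq, Finset.sum_comm, Finset.sum_comm (γ := κ), Finset.mul_sum]
  refine Finset.sum_le_sum fun j _ => ?_
  simpa [dotProduct, sq, Matrix.mulVec, Matrix.mul_apply] using
    dotProduct_mulVec_self_le M (fun k => N k j)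

theorem frobNorm_mul_le_right [DecidableEq κ] [DecidableEq μ] (M : Matrix ι κ ℝ)
    (N : Matrix κ μ ℝ) : frobNorm (M * N) ≤ frobNorm M * specNorm N := by
  rw [← frobNorm_transpose, Matrix.transpose_mul, ← frobNorm_transpose M, ← specNorm_transpose N,
    mul_comm]
  exact frobNorm_mul_le_left _ _

theorem frobNorm_le_sqrt_mul_specNorm {n : ℕ} (N : Matrix ι (Fin n) ℝ) :
    frobNorm N ≤ √n * specNorm N := by
  have := frobNorm_mul_le_left N (1 : Matrix (Fin n) (Fin n) ℝ)
  rwa [Matrix.mul_one, frobNorm_one, mul_comm] at this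

/-- Perturbation bound for the pseudo-inverse `X'` of a matrix `X` of full column rank. -/
theorem frobNorm_leftInverse_sub_le [DecidableEq ι] [DecidableEq κ] {X Y : Matrix ι κ ℝ}
    {X' Y' : Matrix κ ι ℝ} (hX : X' * X = 1) (hXt : (X * X')ᵀ = X * X')
    (hY : Y' * Y = 1) (hYt : (Y * Y')ᵀ = Y * Y') :
    frobNorm (X' - Y') ≤
      (specNorm X' ^ 2 + specNorm X' * specNorm Y') * frobNorm (X - Y) := by
  have hYP : Y * Y' * (Y * Y') = Y * Y' := by
    rw [Matrix.mul_assoc, ← Matrix.mul_assoc Y', hY, Matrix.one_mul]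
  have hYz : Yᵀ * (1 - Y * Y') = 0 := by
    rw [Matrix.mul_sub, Matrix.mul_one, ← hYt, ← Matrix.transpose_mul, Matrix.mul_assoc, hY,
      Matrix.mul_one, sub_self]
  have hX' : X' = X' * X'ᵀ * Xᵀ := by
    rw [Matrix.mul_assoc, ← Matrix.transpose_mul, hXt, ← Matrix.mul_assoc, hX, Matrix.one_mul]
  -- Since `1 - YY'` annihilates the range of `Y`, `Xᵀ(1 - YY') = (X - Y)ᵀ(1 - YY')`. This makes the
  -- part of `X'` off the range of `Y` linear in `X - Y` too.
  have key : X' - Y' = -(X' * ((X - Y) * Y')) +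
      X' * (X'ᵀ * ((X - Y)ᵀ * (1 - Y * Y'))) := by
    have h1 : X' * (X'ᵀ * ((X - Y)ᵀ * (1 - Y * Y'))) = X' * (1 - Y * Y') := by
      rw [Matrix.transpose_sub, Matrix.sub_mul, hYz, sub_zero, ← Matrix.mul_assoc X'ᵀ,
        ← Matrix.mul_assoc, ← Matrix.mul_assoc X', ← hX']
    rw [h1, Matrix.sub_mul, Matrix.mul_sub, Matrix.mul_sub, Matrix.mul_one, ← Matrix.mul_assoc X',
      hX, Matrix.one_mul]
    abel
  have b1 : frobNorm (X' * ((X - Y) * Y')) ≤ specNorm X' * (frobNorm (X - Y) * specNorm Y') :=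
    (frobNorm_mul_le_left _ _).trans
      (mul_le_mul_of_nonneg_left (frobNorm_mul_le_right _ _) (specNorm_nonneg _))
  have b2 : frobNorm (X' * (X'ᵀ * ((X - Y)ᵀ * (1 - Y * Y')))) ≤
      specNorm X' * (specNorm X' * frobNorm (X - Y)) := by
    refine (frobNorm_mul_le_left _ _).trans
      (mul_le_mul_of_nonneg_left ?_ (specNorm_nonneg _))
    refine (frobNorm_mul_le_left _ _).trans ?_
    rw [specNorm_transpose]
    refine mul_le_mul_of_nonneg_left ?_ (specNorm_nonneg _)
    exact (frobNorm_mul_one_sub_le _ hYP hYt).trans (frobNorm_transpose _).le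
  rw [key]
  refine (frobNorm_add_le _ _).trans ?_
  rw [frobNorm_neg]
  linarith

end Norms

/-! ### Min-max bounds for singular values. -/

section SingularValues

theorem dotProduct_self_eq_norm_sq {κ : Type*} [Fintype κ] (v : κ → ℝ) :
    v ⬝ᵥ v = ‖WithLp.toLp 2 v‖ ^ 2 := by
  rw [EuclideanSpace.norm_sq_eq]
  simp [dotProduct, sq]

theorem mulVec_dotProduct_mulVec_self {ι κ : Type*} [Fintype ι] [Fintype κ] (M : Matrix ι κ ℝ)
    (x : κ → ℝ) : M *ᵥ x ⬝ᵥ M *ᵥ x = x ⬝ᵥ (Mᵀ * M) *ᵥ x := by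
  rw [← Matrix.mulVec_mulVec, Matrix.dotProduct_mulVec, Matrix.vecMul_mulVec,
    Matrix.dotProduct_mulVec, Matrix.dotProduct_mulVec, Matrix.vecMul_vecMul]

variable {ι κ : Type*} [Fintype ι] [Fintype κ] [DecidableEq κ] {n : ℕ}

/-- Lower bounds of `M` on an `n`-dimensional subspace are bounds for the singular values of a
singular value decomposition of length `n`. -/
theorem IsSVD.le_of_forall_mulVec {L : Matrix ι κ ℝ} {U : Matrix ι (Fin n) ℝ} {s : Fin n → ℝ}
    {V : Matrix κ (Fin n) ℝ} (h : IsSVD L U s V) {K : Matrix κ (Fin n) ℝ} (hK : Kᵀ * K = 1)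
    {c : ℝ} (hLK : ∀ y, c ^ 2 * (y ⬝ᵥ y) ≤ (L * K) *ᵥ y ⬝ᵥ (L * K) *ᵥ y) (i : Fin n) :
    c ≤ s i := by
  obtain ⟨k, rfl⟩ : ∃ k, n = k + 1 := ⟨n - 1, by have := i.pos; omega⟩
  refine le_trans ?_ (h.antitone (Fin.le_last i))
  set t := Fin.last k
  -- Zeroing the last row of `VᵀK` makes it singular. For a kernel vector `y`, `VᵀKy` lives on the
  -- last coordinate alone, so `LKy` only sees the smallest singular value `s t`.
  obtain ⟨y, hy0, hy⟩ := Matrix.exists_mulVec_eq_zero_iff.2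
    (Matrix.det_eq_zero_of_row_eq_zero (A := (Vᵀ * K).updateRow t 0) t (by simp))
  have hyz : ∀ j, j ≠ t → ((Vᵀ * K) *ᵥ y) j = 0 := by
    intro j hj
    have := congrFun hy j
    simpa [Matrix.mulVec, Matrix.updateRow_ne hj] using this
  have hw : ((Vᵀ * K) *ᵥ y) t ^ 2 ≤ y ⬝ᵥ y := by
    have h1 : (Vᵀ * K) *ᵥ y ⬝ᵥ (Vᵀ * K) *ᵥ y ≤ y ⬝ᵥ y := by
      refine (dotProduct_mulVec_self_le _ _).trans ?_
      have h2 : specNorm (Vᵀ * K) ≤ 1 := by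
        refine (specNorm_mul_le _ _).trans ?_
        rw [specNorm_transpose]
        exact mul_le_one₀ (specNorm_le_one_of_transpose_mul_self_eq_one h.right_orthonormal)
          (specNorm_nonneg _) (specNorm_le_one_of_transpose_mul_self_eq_one hK)
      have h3 : specNorm (Vᵀ * K) ^ 2 ≤ 1 := pow_le_one₀ (specNorm_nonneg _) h2
      have h4 : 0 ≤ y ⬝ᵥ y := Finset.sum_nonneg fun j _ => mul_self_nonneg (y j)
      nlinarith
    refine le_trans ?_ h1
    rw [sq]
    exact Finset.single_le_sum (f := fun j => ((Vᵀ * K) *ᵥ y) j * ((Vᵀ * K) *ᵥ y) j)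
      (fun j _ => mul_self_nonneg _) (Finset.mem_univ t)
  have hL : (L * K) *ᵥ y ⬝ᵥ (L * K) *ᵥ y = s t ^ 2 * ((Vᵀ * K) *ᵥ y) t ^ 2 := by
    have e : (L * K) *ᵥ y = U *ᵥ (Matrix.diagonal s *ᵥ ((Vᵀ * K) *ᵥ y)) := by
      simp only [Matrix.mulVec_mulVec, h.eq_mul, Matrix.mul_assoc]
    rw [e, mulVec_dotProduct_mulVec_self, h.left_orthonormal, Matrix.one_mulVec, dotProduct,
      Finset.sum_eq_single t]
    · rw [Matrix.mulVec_diagonal]; ring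
    · intro j _ hj
      rw [Matrix.mulVec_diagonal, hyz j hj]; ring
    · simp
  have hyp : 0 < y ⬝ᵥ y := by
    refine lt_of_le_of_ne (Finset.sum_nonneg fun j _ => mul_self_nonneg (y j)) ?_
    intro h0
    exact hy0 (dotProduct_self_eq_zero.1 h0.symm)
  have hfin : c ^ 2 * (y ⬝ᵥ y) ≤ s t ^ 2 * (y ⬝ᵥ y) :=
    (hLK y).trans (hL.le.trans (mul_le_mul_of_nonneg_left hw (sq_nonneg _)))
  exact le_of_sq_le_sq (le_of_mul_le_mul_right hfin hyp) (h.nonneg t)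

/-- If the `n`-th singular value is positive, it is a lower bound on an `n`-dimensional subspace. -/
theorem exists_orthonormal_nthSingularValue_le [DecidableEq ι] (hn : 0 < n) (L : Matrix ι κ ℝ)
    (hpos : 0 < nthSingularValue n L) :
    ∃ K : Matrix κ (Fin n) ℝ, Kᵀ * K = 1 ∧
      ∀ y, nthSingularValue n L ^ 2 * (y ⬝ᵥ y) ≤ (L * K) *ᵥ y ⬝ᵥ (L * K) *ᵥ y := by
  set T := Matrix.toEuclideanLin L with hT
  -- Singular values are indexed from `0` and vanish from the dimension of the domain onwards, so a
  -- positive value at index `n - 1` forces the dimension to be at least `n`.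
  have hcard : n ≤ Module.finrank ℝ (EuclideanSpace ℝ κ) := by
    by_contra hlt
    refine hpos.ne' ?_
    exact T.singularValues_of_finrank_le (by omega)
  set b := T.isSymmetric_adjoint_comp_self.eigenvectorBasis rfl
  set lam := T.isSymmetric_adjoint_comp_self.eigenvalues rfl with hlam
  -- The columns of `K` are eigenvectors of `LᵀL` for its `n` largest eigenvalues.
  let K : Matrix κ (Fin n) ℝ := Matrix.of fun j i => b (Fin.castLE hcard i) j
  have hK : Kᵀ * K = 1 := by
    ext i j
    have := orthonormal_iff_ite.1 b.orthonormal (Fin.castLE hcard j) (Fin.castLE hcard i)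
    rw [EuclideanSpace.inner_eq_star_dotProduct] at this
    simp only [Matrix.mul_apply, Matrix.transpose_apply, Matrix.one_apply, K, Matrix.of_apply]
    simp only [dotProduct, star_trivial, Fin.castLE_inj] at this
    simp only [eq_comm (a := i)]
    exact this
  have hTT : T.adjoint ∘ₗ T = Matrix.toEuclideanLin (Lᵀ * L) := by
    rw [hT, ← Matrix.toEuclideanLin_conjTranspose_eq_adjoint,
      Matrix.conjTranspose_eq_transpose_of_trivial]
    ext x : 1
    simp [Matrix.toLpLin_apply, Matrix.mulVec_mulVec]
  have hLK : Lᵀ * L * K = K * Matrix.diagonal (fun i => lam (Fin.castLE hcard i)) := by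
    ext j i
    have := T.isSymmetric_adjoint_comp_self.apply_eigenvectorBasis rfl (Fin.castLE hcard i)
    have h2 := congrArg (fun v : EuclideanSpace ℝ κ => v j)
      ((LinearMap.congr_fun hTT _).symm.trans this)
    rw [Matrix.mul_diagonal, Matrix.mul_apply]
    simp only [Matrix.toLpLin_apply, Matrix.mulVec, dotProduct, PiLp.smul_apply, smul_eq_mul,
      RCLike.ofReal_real_eq_id, id] at h2
    simp only [K, Matrix.of_apply]
    rw [mul_comm (b _ _)]
    exact h2
  refine ⟨K, hK, fun y => ?_⟩
  have hD : (L * K)ᵀ * (L * K) = Matrix.diagonal (fun i => lam (Fin.castLE hcard i)) := by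
    rw [Matrix.transpose_mul, Matrix.mul_assoc, ← Matrix.mul_assoc Lᵀ, hLK, ← Matrix.mul_assoc, hK,
      Matrix.one_mul]
  rw [mulVec_dotProduct_mulVec_self, hD, dotProduct, dotProduct, Finset.mul_sum]
  refine Finset.sum_le_sum fun i _ => ?_
  have hle : nthSingularValue n L ^ 2 ≤ lam (Fin.castLE hcard i) := by
    have h1 : nthSingularValue n L ≤ T.singularValues i :=
      T.singularValues_antitone (by have := i.2; omega)
    rw [hlam, ← T.sq_singularValues_fin rfl]
    exact pow_le_pow_left₀ hpos.le h1 2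
  rw [Matrix.mulVec_diagonal]
  nlinarith [mul_self_nonneg (y i)]

/-- Lower bounds on a subspace are stable under perturbation. -/
theorem forall_mulVec_of_specNorm_sub_le {L M : Matrix ι κ ℝ} {K : Matrix κ (Fin n) ℝ}
    (hK : Kᵀ * K = 1) {c d : ℝ} (hd : 0 ≤ d) (hLM : specNorm (L - M) ≤ c - d)
    (hL : ∀ y, c ^ 2 * (y ⬝ᵥ y) ≤ (L * K) *ᵥ y ⬝ᵥ (L * K) *ᵥ y) (y : Fin n → ℝ) :
    d ^ 2 * (y ⬝ᵥ y) ≤ (M * K) *ᵥ y ⬝ᵥ (M * K) *ᵥ y := by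
  have h1 := hL y
  have h2 := dotProduct_mulVec_self_le ((L - M) * K) y
  have h3 : specNorm ((L - M) * K) ≤ c - d := by
    refine (specNorm_mul_le _ _).trans ?_
    have := specNorm_le_one_of_transpose_mul_self_eq_one hK
    nlinarith [specNorm_nonneg (L - M)]
  rw [dotProduct_self_eq_norm_sq, dotProduct_self_eq_norm_sq, ← mul_pow] at h1 h2 ⊢
  have h1' := le_of_sq_le_sq h1 (norm_nonneg _)
  have h2' := le_of_sq_le_sq h2 (mul_nonneg (specNorm_nonneg _) (norm_nonneg _))
  refine pow_le_pow_left₀ (mul_nonneg hd (norm_nonneg _)) ?_ 2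
  have h4 : ‖WithLp.toLp 2 ((L * K) *ᵥ y)‖ ≤
      ‖WithLp.toLp 2 ((M * K) *ᵥ y)‖ + ‖WithLp.toLp 2 (((L - M) * K) *ᵥ y)‖ := by
    refine le_trans (le_of_eq ?_) (norm_add_le _ _)
    rw [← WithLp.toLp_add, ← Matrix.add_mulVec, ← Matrix.add_mul, add_sub_cancel]
  have h5 := mul_le_mul_of_nonneg_right h3 (norm_nonneg (WithLp.toLp 2 y))
  linarith

end SingularValues

/-! ### Orthogonal alignment of balanced factors. -/

section Procrustes

variable {ι κ : Type*} [Fintype ι] [Fintype κ] {n : ℕ}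

/-- Polar decomposition: every square matrix becomes positive semidefinite after multiplication
by a suitable orthogonal matrix. -/
theorem exists_orthogonal_mul_posSemidef (M : Matrix (Fin n) (Fin n) ℝ) :
    ∃ W ∈ Matrix.orthogonalGroup (Fin n) ℝ, (M * W).PosSemidef := by
  have hS : (Mᵀ * M).IsHermitian := by
    simpa using Matrix.isHermitian_conjTranspose_mul_self M
  obtain ⟨V, d, hV, hSd⟩ : ∃ (V : Matrix (Fin n) (Fin n) ℝ) (d : Fin n → ℝ),
      Vᵀ * V = 1 ∧ Mᵀ * M = V * Matrix.diagonal d * Vᵀ := by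
    refine ⟨hS.eigenvectorUnitary, hS.eigenvalues, ?_, ?_⟩
    · have := Matrix.UnitaryGroup.star_mul_self hS.eigenvectorUnitary
      simpa [Matrix.star_eq_conjTranspose] using this
    · have := hS.spectral_theorem
      simpa [Matrix.star_eq_conjTranspose, Unitary.conjStarAlgAut_apply] using this
  let f : Fin n → EuclideanSpace ℝ (Fin n) := fun i => WithLp.toLp 2 fun j => (M * V) j i
  have hMV : (M * V)ᵀ * (M * V) = Matrix.diagonal d := by
    rw [Matrix.transpose_mul, Matrix.mul_assoc, ← Matrix.mul_assoc Mᵀ, hSd, Matrix.mul_assoc,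
      Matrix.mul_assoc, hV, Matrix.mul_one, ← Matrix.mul_assoc, hV, Matrix.one_mul]
  have hf : Pairwise fun i j => inner ℝ (f i) (f j) = 0 := by
    intro i j hij
    have h1 := congrFun (congrFun hMV j) i
    rw [Matrix.diagonal_apply_ne _ hij.symm, Matrix.mul_apply] at h1
    rw [EuclideanSpace.inner_eq_star_dotProduct]
    simpa [f, dotProduct] using h1
  have hcard : Module.finrank ℝ (EuclideanSpace ℝ (Fin n)) = Fintype.card (Fin n) := by simp
  -- The columns of `MV` are orthogonal, so Gram-Schmidt only normalises the nonzero ones and fills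
  -- in the directions where a column vanishes. No invertibility of `M` is needed.
  set b := InnerProductSpace.gramSchmidtOrthonormalBasis hcard f
  have hb : ∀ i, f i = ‖f i‖ • b i := by
    intro i
    by_cases h0 : f i = 0
    · simp [h0]
    · rw [InnerProductSpace.gramSchmidtOrthonormalBasis_apply_of_orthogonal hcard hf h0]
      simp [smul_smul, h0]
  let U : Matrix (Fin n) (Fin n) ℝ := Matrix.of fun j i => b i j
  have hU : Uᵀ * U = 1 := by
    ext i j
    have := orthonormal_iff_ite.1 b.orthonormal j i
    rw [EuclideanSpace.inner_eq_star_dotProduct] at this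
    simp only [Matrix.mul_apply, Matrix.transpose_apply, Matrix.one_apply, U, Matrix.of_apply]
    simp only [dotProduct, star_trivial] at this
    simp only [eq_comm (a := i)]
    exact this
  have hMU : M * V = U * Matrix.diagonal fun i => ‖f i‖ := by
    ext j i
    have := congrArg (fun v : EuclideanSpace ℝ (Fin n) => v j) (hb i)
    rw [Matrix.mul_diagonal, mul_comm]
    exact this
  -- With `MV = U diag‖f i‖`, this choice gives `MW = U diag‖f i‖ Uᵀ`.
  refine ⟨V * Uᵀ, ?_, ?_⟩
  · rw [Matrix.mem_orthogonalGroup_iff', Matrix.transpose_mul,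
      Matrix.transpose_transpose, Matrix.mul_assoc, ← Matrix.mul_assoc Vᵀ, hV, Matrix.one_mul]
    exact mul_eq_one_comm.1 hU
  · rw [← Matrix.mul_assoc, hMU]
    simpa using (Matrix.PosSemidef.diagonal (d := fun i => ‖f i‖)
      (fun i => norm_nonneg _)).mul_mul_conjTranspose_same U

/-- Cyclicity of the trace moves everything to small Gram matrices, where the Procrustes argument
takes place. -/
theorem frobNorm_mul_transpose_sub_sq (X Y : Matrix ι κ ℝ) :
    frobNorm (X * Xᵀ - Y * Yᵀ) ^ 2 = (Xᵀ * X * (Xᵀ * X)).trace + (Yᵀ * Y * (Yᵀ * Y)).trace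
      - 2 * ((Xᵀ * Y)ᵀ * (Xᵀ * Y)).trace := by
  have h : ∀ A B : Matrix ι κ ℝ,
      (A * Aᵀ * (B * Bᵀ)).trace = ((Aᵀ * B)ᵀ * (Aᵀ * B)).trace := by
    intro A B
    rw [Matrix.transpose_mul, Matrix.transpose_transpose, ← Matrix.mul_assoc,
      Matrix.trace_mul_comm]
    simp only [Matrix.mul_assoc]
  have h' : ((Yᵀ * X)ᵀ * (Yᵀ * X)).trace = ((Xᵀ * Y)ᵀ * (Xᵀ * Y)).trace := by
    rw [← h, ← h, Matrix.trace_mul_comm]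
  rw [frobNorm_sq_eq_trace]
  simp only [Matrix.transpose_sub, Matrix.transpose_mul, Matrix.transpose_transpose,
    Matrix.sub_mul, Matrix.mul_sub, Matrix.trace_sub, h] at h' ⊢
  linarith

/-- The Procrustes bound for optimally aligned matrices. -/
theorem mul_frobNorm_sub_sq_le {X Y : Matrix ι (Fin n) ℝ} (hXY : (Xᵀ * Y).PosSemidef)
    {t : Fin n → ℝ} (hX : Xᵀ * X = Matrix.diagonal t) {c : ℝ} (hc : ∀ i, c ≤ t i) :
    4 / 5 * c * frobNorm (X - Y) ^ 2 ≤ frobNorm (X * Xᵀ - Y * Yᵀ) ^ 2 := by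
  obtain ⟨D, rfl⟩ : ∃ D, Y = X + D := ⟨Y - X, by abel⟩
  have hSt : (Xᵀ * (X + D))ᵀ = Xᵀ * (X + D) := by
    simpa using hXY.isHermitian.eq
  have hNt : (Xᵀ * D)ᵀ = Xᵀ * D := by
    have : Xᵀ * D = Xᵀ * (X + D) - Xᵀ * X := by rw [Matrix.mul_add]; abel
    rw [this, Matrix.transpose_sub, hSt]
    simp
  have hNt' : Dᵀ * X = Xᵀ * D := by simpa using hNt
  rw [frobNorm_mul_transpose_sub_sq, hSt]
  have hYY : (X + D)ᵀ * (X + D) = Xᵀ * X + Xᵀ * D + Xᵀ * D + Dᵀ * D := by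
    rw [Matrix.transpose_add, Matrix.add_mul, Matrix.mul_add, Matrix.mul_add, hNt']
    abel
  -- This is where the alignment enters: the positive semidefinite `XᵀY` pairs nonnegatively with
  -- `DᵀD`.
  have hS0 : 0 ≤ (Xᵀ * (X + D) * (Dᵀ * D)).trace := by
    have := (hXY.mul_mul_conjTranspose_same D).trace_nonneg
    rwa [Matrix.conjTranspose_eq_transpose_of_trivial, Matrix.mul_assoc, Matrix.trace_mul_comm,
      Matrix.mul_assoc] at this
  have hE0 : frobNorm (X - (X + D)) ^ 2 = (Dᵀ * D).trace := by
    rw [frobNorm_sq_eq_trace]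
    simp
  have hG : c * (Dᵀ * D).trace ≤ (Xᵀ * X * (Dᵀ * D)).trace := by
    rw [hX, Matrix.trace, Matrix.trace, Finset.mul_sum]
    refine Finset.sum_le_sum fun i _ => ?_
    rw [Matrix.diag_apply, Matrix.diag_apply, Matrix.diagonal_mul]
    refine mul_le_mul_of_nonneg_right (hc i) ?_
    rw [Matrix.mul_apply]
    exact Finset.sum_nonneg fun j _ => mul_self_nonneg _
  rw [hYY, hE0, Matrix.mul_add]
  rw [Matrix.mul_add] at hS0
  set G := Xᵀ * X
  set N := Xᵀ * D
  set E := Dᵀ * D with hE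
  have hEt : Eᵀ = E := by simp [hE]
  -- Any factor up to `√2` would be covered by the available `2 tr N²`; `7/5` is a rational value
  -- just below it.
  have hq : 0 ≤ ((E + (7 / 5 : ℝ) • N) * (E + (7 / 5 : ℝ) • N)).trace := by
    have := sq_nonneg (frobNorm (E + (7 / 5 : ℝ) • N))
    rwa [frobNorm_sq_eq_trace, Matrix.transpose_add, Matrix.transpose_smul, hEt, hNt] at this
  have hN : 0 ≤ (N * N).trace := by
    have := sq_nonneg (frobNorm N)
    rwa [frobNorm_sq_eq_trace, hNt] at this
  have c1 := Matrix.trace_mul_comm N G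
  have c2 := Matrix.trace_mul_comm E G
  have c3 := Matrix.trace_mul_comm E N
  simp only [Matrix.add_mul, Matrix.mul_add, Matrix.trace_add, Matrix.smul_mul, Matrix.mul_smul,
    Matrix.trace_smul, smul_eq_mul] at hq hS0 ⊢
  -- The right side is `2 tr N² + tr E² + 2 tr GE + 4 tr NE`. It equals `tr (E + 7/5 N)² + 1/25 tr
  -- N² + 6/5 tr (G + N)E + 4/5 tr GE`; the first three terms are nonnegative and `hG` bounds the
  -- last.
  linarith

/-- Balanced factorizations depend on the product in a controlled way. -/
theorem frobNorm_fromRows_mul_transpose_sub_sq_le {O O' : Matrix ι (Fin n) ℝ}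
    {Q Q' : Matrix (Fin n) κ ℝ} (h : Oᵀ * O = Q * Qᵀ) (h' : O'ᵀ * O' = Q' * Q'ᵀ) :
    frobNorm (Matrix.fromRows O Qᵀ * (Matrix.fromRows O Qᵀ)ᵀ -
      Matrix.fromRows O' Q'ᵀ * (Matrix.fromRows O' Q'ᵀ)ᵀ) ^ 2 ≤
      4 * frobNorm (O * Q - O' * Q') ^ 2 := by
  have hr : ∀ (A B : Matrix ι (Fin n) ℝ) (C D : Matrix (Fin n) κ ℝ),
      (Matrix.fromRows A Cᵀ)ᵀ * Matrix.fromRows B Dᵀ = Aᵀ * B + C * Dᵀ := by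
    intro A B C D
    rw [Matrix.transpose_fromRows, Matrix.fromCols_mul_fromRows, Matrix.transpose_transpose]
  have hp : ∀ (A B : Matrix ι (Fin n) ℝ) (C D : Matrix (Fin n) κ ℝ),
      ((A * C)ᵀ * (B * D)).trace = (Aᵀ * B * (C * Dᵀ)ᵀ).trace := by
    intro A B C D
    rw [Matrix.transpose_mul, Matrix.mul_assoc, Matrix.trace_mul_comm, Matrix.transpose_mul,
      Matrix.transpose_transpose]
    simp only [Matrix.mul_assoc]
  rw [frobNorm_mul_transpose_sub_sq, frobNorm_sq_eq_trace, hr, hr, hr, h, h']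
  simp only [Matrix.transpose_sub, Matrix.sub_mul, Matrix.mul_sub, Matrix.trace_sub, hp, h, h']
  -- The gap between the two sides is exactly twice this square.
  have hq := sq_nonneg (frobNorm (Oᵀ * O' - Q * Q'ᵀ))
  rw [frobNorm_sq_eq_trace] at hq
  have e1 : (O'ᵀ * O * (Q' * Qᵀ)ᵀ).trace = (Oᵀ * O' * (Q * Q'ᵀ)ᵀ).trace := by
    rw [← Matrix.trace_transpose, ← Matrix.trace_mul_comm]
    simp [Matrix.mul_assoc]
  have e2 := Matrix.trace_mul_comm (Oᵀ * O') (Q * Q'ᵀ)ᵀ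
  have e3 : ((Oᵀ * O')ᵀ * (Q * Q'ᵀ)).trace = ((Q * Q'ᵀ)ᵀ * (Oᵀ * O')).trace := by
    rw [← Matrix.trace_transpose, Matrix.transpose_mul, Matrix.transpose_transpose]
  rw [e1]
  have f1 : (Q * Qᵀ)ᵀ = Q * Qᵀ := by simp
  have f2 : (Q' * Q'ᵀ)ᵀ = Q' * Q'ᵀ := by simp
  rw [f1, f2]
  generalize Oᵀ * O' = P at *
  generalize Q * Q'ᵀ = R at *
  simp only [Matrix.transpose_sub, Matrix.transpose_add, Matrix.add_mul, Matrix.sub_mul,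
    Matrix.mul_sub, Matrix.mul_add, Matrix.trace_add, Matrix.trace_sub] at hq ⊢
  linarith

/-- The difference of two matrices of rank at most `n` has rank at most `2 n`. -/
theorem IsSVD.frobNorm_sub_sq_le [DecidableEq ι] [DecidableEq κ] {L L' : Matrix ι κ ℝ}
    {U U' : Matrix ι (Fin n) ℝ} {s s' : Fin n → ℝ} {V V' : Matrix κ (Fin n) ℝ}
    (h : IsSVD L U s V) (h' : IsSVD L' U' s' V') :
    frobNorm (L - L') ^ 2 ≤ 2 * n * specNorm (L - L') ^ 2 := by
  set δ := specNorm (L - L')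
  have hP : V * Vᵀ * (V * Vᵀ) = V * Vᵀ := by
    rw [Matrix.mul_assoc, ← Matrix.mul_assoc Vᵀ, h.right_orthonormal, Matrix.one_mul]
  have hPt : (V * Vᵀ)ᵀ = V * Vᵀ := by simp
  have hLz : L * (1 - V * Vᵀ) = 0 := by
    rw [h.eq_mul, Matrix.mul_assoc, Matrix.mul_sub, ← Matrix.mul_assoc Vᵀ, h.right_orthonormal]
    simp
  have hU' : U' * (U'ᵀ * L') = L' := by
    rw [h'.eq_mul, Matrix.mul_assoc U', ← Matrix.mul_assoc U'ᵀ, h'.left_orthonormal,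
      Matrix.one_mul]
  have h1 : frobNorm ((L - L') * (V * Vᵀ)) ≤ √n * δ := by
    rw [← frobNorm_transpose, ← Matrix.mul_assoc, Matrix.transpose_mul, Matrix.transpose_transpose,
      frobNorm_mul_of_transpose_mul_self_eq_one h.right_orthonormal, frobNorm_transpose, mul_comm,
      ← frobNorm_of_transpose_mul_self_eq_one h.right_orthonormal]
    exact frobNorm_mul_le_left _ _
  -- Off the range of `V` only `L'` survives, and its columns lie in the range of `U'`. Each of the
  -- two pieces thus has rank at most `n`.
  have h2 : frobNorm ((L - L') * (1 - V * Vᵀ)) ≤ √n * δ := by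
    have e : (L - L') * (1 - V * Vᵀ) = U' * (U'ᵀ * (L - L') * (1 - V * Vᵀ)) := by
      rw [Matrix.mul_assoc, Matrix.sub_mul, hLz, zero_sub, Matrix.mul_neg, Matrix.mul_neg,
        ← Matrix.mul_assoc U'ᵀ, ← Matrix.mul_assoc U', hU']
    rw [e, frobNorm_mul_of_transpose_mul_self_eq_one h'.left_orthonormal]
    refine (frobNorm_mul_one_sub_le _ hP hPt).trans ?_
    refine (frobNorm_mul_le_right _ _).trans ?_
    rw [frobNorm_transpose, frobNorm_of_transpose_mul_self_eq_one h'.left_orthonormal]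
  rw [frobNorm_sq_add_of_isIdempotent _ hP hPt]
  have h3 := pow_le_pow_left₀ (frobNorm_nonneg _) h1 2
  have h4 := pow_le_pow_left₀ (frobNorm_nonneg _) h2 2
  rw [mul_pow, Real.sq_sqrt (Nat.cast_nonneg n)] at h3 h4
  linarith

/-- The balanced factors of two nearby matrices are close up to an orthogonal change of basis. -/
theorem IsSVD.exists_orthogonal_frobNorm_sub_le [DecidableEq ι] [DecidableEq κ]
    {L L' : Matrix ι κ ℝ}
    {U U' : Matrix ι (Fin n) ℝ} {s s' : Fin n → ℝ} {V V' : Matrix κ (Fin n) ℝ}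
    (h : IsSVD L U s V) (h' : IsSVD L' U' s' V') {σ : ℝ} (hσ : ∀ i, σ ≤ s i) :
    ∃ W ∈ Matrix.orthogonalGroup (Fin n) ℝ,
      σ * (frobNorm (U * (Matrix.diagonal fun i => √(s i)) -
          U' * (Matrix.diagonal fun i => √(s' i)) * W) ^ 2 +
        frobNorm ((Matrix.diagonal fun i => √(s i)) * Vᵀ -
          Wᵀ * ((Matrix.diagonal fun i => √(s' i)) * V'ᵀ)) ^ 2) ≤
      5 * n * specNorm (L - L') ^ 2 := by
  have key : ∀ {M : Matrix ι κ ℝ} {A : Matrix ι (Fin n) ℝ} {d : Fin n → ℝ}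
      {B : Matrix κ (Fin n) ℝ}, IsSVD M A d B →
      (A * (Matrix.diagonal fun i => √(d i)))ᵀ * (A * (Matrix.diagonal fun i => √(d i))) =
          Matrix.diagonal d ∧
      ((Matrix.diagonal fun i => √(d i)) * Bᵀ) * ((Matrix.diagonal fun i => √(d i)) * Bᵀ)ᵀ =
          Matrix.diagonal d ∧
      (A * (Matrix.diagonal fun i => √(d i))) * ((Matrix.diagonal fun i => √(d i)) * Bᵀ) = M := by
    intro M A d B hM
    have hd : (Matrix.diagonal fun i => √(d i)) * (Matrix.diagonal fun i => √(d i)) =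
        Matrix.diagonal d := by
      rw [Matrix.diagonal_mul_diagonal]
      congr 1
      funext i
      exact Real.mul_self_sqrt (hM.nonneg i)
    refine ⟨?_, ?_, ?_⟩
    · rw [Matrix.transpose_mul, Matrix.mul_assoc, ← Matrix.mul_assoc Aᵀ, hM.left_orthonormal,
        Matrix.one_mul, Matrix.diagonal_transpose, hd]
    · rw [Matrix.transpose_mul, Matrix.mul_assoc, Matrix.transpose_transpose,
        ← Matrix.mul_assoc Bᵀ, hM.right_orthonormal, Matrix.one_mul, Matrix.diagonal_transpose, hd]
    · rw [Matrix.mul_assoc, ← Matrix.mul_assoc (Matrix.diagonal _), hd, ← Matrix.mul_assoc,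
        ← hM.eq_mul]
  obtain ⟨kO, kQ, kL⟩ := key h
  obtain ⟨kO', kQ', kL'⟩ := key h'
  set O := U * (Matrix.diagonal fun i => √(s i))
  set O' := U' * (Matrix.diagonal fun i => √(s' i))
  set Q := (Matrix.diagonal fun i => √(s i)) * Vᵀ
  set Q' := (Matrix.diagonal fun i => √(s' i)) * V'ᵀ
  obtain ⟨W, hW, hpsd⟩ := exists_orthogonal_mul_posSemidef
    ((Matrix.fromRows O Qᵀ)ᵀ * Matrix.fromRows O' Q'ᵀ)
  refine ⟨W, hW, ?_⟩
  rw [Matrix.mul_assoc] at hpsd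
  have hWW : W * Wᵀ = 1 := (Matrix.mem_orthogonalGroup_iff _ _).1 hW
  have hZ : (Matrix.fromRows O Qᵀ)ᵀ * Matrix.fromRows O Qᵀ =
      Matrix.diagonal fun i => s i + s i := by
    rw [Matrix.transpose_fromRows, Matrix.fromCols_mul_fromRows, Matrix.transpose_transpose, kO,
      kQ, Matrix.diagonal_add]
  -- The two Gram blocks add up, hence the lower bound `2σ`.
  have h1 := mul_frobNorm_sub_sq_le hpsd hZ (c := σ + σ) fun i => add_le_add (hσ i) (hσ i)
  have hYY : Matrix.fromRows O' Q'ᵀ * W * (Matrix.fromRows O' Q'ᵀ * W)ᵀ =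
      Matrix.fromRows O' Q'ᵀ * (Matrix.fromRows O' Q'ᵀ)ᵀ := by
    rw [Matrix.transpose_mul _ W, Matrix.mul_assoc, ← Matrix.mul_assoc W, hWW, Matrix.one_mul]
  rw [hYY] at h1
  have h2 := frobNorm_fromRows_mul_transpose_sub_sq_le (kO.trans kQ.symm) (kO'.trans kQ'.symm)
  rw [kL, kL'] at h2
  have h3 := h.frobNorm_sub_sq_le h'
  have h4 : frobNorm (Matrix.fromRows O Qᵀ - Matrix.fromRows O' Q'ᵀ * W) ^ 2 =
      frobNorm (O - O' * W) ^ 2 + frobNorm (Q - Wᵀ * Q') ^ 2 := by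
    have e : (Q - Wᵀ * Q')ᵀ = Qᵀ - Q'ᵀ * W := by
      rw [Matrix.transpose_sub, Matrix.transpose_mul Wᵀ, Matrix.transpose_transpose]
    rw [← frobNorm_transpose (Q - Wᵀ * Q'), e, frobNorm_sq, frobNorm_sq, frobNorm_sq,
      Fintype.sum_sum_type, Matrix.fromRows_mul]
    rfl
  rw [h4] at h1
  -- `4/5 · 2σ‖Z - Z'W‖_F² ≤ 4 · 2nδ²`, where `Z`, `Z'` are the stacked factors and `δ` is the
  -- spectral norm of `L - L'`; this gives the constant `5`.
  linarith

end Procrustes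

/-! ### Pseudo-inverses of balanced factors. -/

section PseudoInverse

variable {ι κ : Type*} [Fintype ι] [Fintype κ]

theorem pinv_eq {M : Matrix ι κ ℝ} {X : Matrix κ ι ℝ} (h : IsMoorePenrose M X) : pinv M = X :=
  (isMoorePenrose_pinv M).unique h

theorem pinv_transpose (M : Matrix ι κ ℝ) : pinv Mᵀ = (pinv M)ᵀ := by
  have h := isMoorePenrose_pinv M
  refine pinv_eq ⟨?_, ?_, ?_, ?_⟩
  · simpa [Matrix.mul_assoc] using congrArg Matrix.transpose h.mul_mul_self
  · simpa [Matrix.mul_assoc] using congrArg Matrix.transpose h.self_mul_mul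
  · rw [← Matrix.transpose_mul, h.symm_right, h.symm_right]
  · rw [← Matrix.transpose_mul, h.symm_left, h.symm_left]

theorem pinv_mul_diagonal [DecidableEq κ] {U : Matrix ι κ ℝ} (hU : Uᵀ * U = 1) {d : κ → ℝ}
    (hd : ∀ i, d i ≠ 0) :
    pinv (U * Matrix.diagonal d) = Matrix.diagonal (fun i => (d i)⁻¹) * Uᵀ := by
  have e1 : Matrix.diagonal d * Matrix.diagonal (fun i => (d i)⁻¹) = 1 := by
    simp [Matrix.diagonal_mul_diagonal, hd]
  have e2 : Matrix.diagonal (fun i => (d i)⁻¹) * Matrix.diagonal d = 1 := by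
    simp [Matrix.diagonal_mul_diagonal, hd]
  have l : Matrix.diagonal (fun i => (d i)⁻¹) * Uᵀ * (U * Matrix.diagonal d) = 1 := by
    rw [Matrix.mul_assoc, ← Matrix.mul_assoc Uᵀ, hU, Matrix.one_mul, e2]
  have r : U * Matrix.diagonal d * (Matrix.diagonal (fun i => (d i)⁻¹) * Uᵀ) = U * Uᵀ := by
    rw [Matrix.mul_assoc, ← Matrix.mul_assoc (Matrix.diagonal d), e1, Matrix.one_mul]
  refine pinv_eq ⟨?_, ?_, ?_, ?_⟩
  · rw [Matrix.mul_assoc, l, Matrix.mul_one]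
  · rw [l, Matrix.one_mul]
  · rw [r]; simp
  · rw [l, Matrix.transpose_one]

/-- The pseudo-inverse of a balanced factor: it is a left inverse, and its norm is controlled by
the smallest singular value. -/
theorem pinv_mul_diagonal_sqrt [DecidableEq ι] [DecidableEq κ] {U : Matrix ι κ ℝ}
    (hU : Uᵀ * U = 1) {s : κ → ℝ} {b : ℝ} (hb : 0 < b) (hs : ∀ i, 1 ≤ b ^ 2 * s i) :
    pinv (U * Matrix.diagonal fun i => √(s i)) * (U * Matrix.diagonal fun i => √(s i)) = 1 ∧
      specNorm (pinv (U * Matrix.diagonal fun i => √(s i))) ≤ b := by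
  have hs0 : ∀ i, 0 < s i := fun i => by
    by_contra hlt
    nlinarith [hs i, sq_nonneg b, not_lt.1 hlt]
  have hd : ∀ i, √(s i) ≠ 0 := fun i => (Real.sqrt_pos.2 (hs0 i)).ne'
  rw [pinv_mul_diagonal hU hd]
  constructor
  · rw [Matrix.mul_assoc, ← Matrix.mul_assoc Uᵀ, hU, Matrix.one_mul, Matrix.diagonal_mul_diagonal]
    simp [hd]
  · refine (specNorm_mul_le _ _).trans ?_
    rw [specNorm_transpose]
    have h1 := specNorm_le_one_of_transpose_mul_self_eq_one hU
    have h2 : specNorm (Matrix.diagonal fun i => (√(s i))⁻¹) ≤ b := by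
      refine specNorm_diagonal_le hb.le fun i => ?_
      rw [abs_of_nonneg (by positivity), inv_le_comm₀ (Real.sqrt_pos.2 (hs0 i)) hb]
      refine Real.le_sqrt_of_sq_le ?_
      rw [inv_pow, inv_le_iff_one_le_mul₀' (by positivity)]
      exact hs i
    exact (mul_le_mul h2 h1 (specNorm_nonneg _) hb.le).trans (mul_one b).le

end PseudoInverse

/-! ### Perturbation of the state matrix. -/

section StateMatrix

variable {ι κ : Type*} [Fintype ι] [Fintype κ] [DecidableEq ι] [DecidableEq κ] {n : ℕ}

/-- Perturbation bound for `X' H Y'` where `X'`, `Y'` are pseudo-inverses of the factors. -/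
theorem frobNorm_mul_mul_sub_le {O O₁ : Matrix ι (Fin n) ℝ} {Q Q₁ : Matrix κ (Fin n) ℝ}
    {X X₁ : Matrix (Fin n) ι ℝ} {Y Y₁ : Matrix (Fin n) κ ℝ}
    (hX : X * O = 1) (hXt : (O * X)ᵀ = O * X) (hX₁ : X₁ * O₁ = 1) (hXt₁ : (O₁ * X₁)ᵀ = O₁ * X₁)
    (hY : Y * Q = 1) (hYt : (Q * Y)ᵀ = Q * Y) (hY₁ : Y₁ * Q₁ = 1) (hYt₁ : (Q₁ * Y₁)ᵀ = Q₁ * Y₁)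
    {a b e : ℝ} (hXa : specNorm X ≤ a) (hYa : specNorm Y ≤ a) (hXb : specNorm X₁ ≤ b)
    (hYb : specNorm Y₁ ≤ b) (hO : frobNorm (O - O₁) ≤ e) (hQ : frobNorm (Q - Q₁) ≤ e)
    (H H₁ : Matrix ι κ ℝ) :
    frobNorm (X * H * Yᵀ - X₁ * H₁ * Y₁ᵀ) ≤
      (a ^ 2 + a * b) * e * (a * specNorm H + b * specNorm H₁) +
        √n * (a * b) * specNorm (H - H₁) := by
  have ha : 0 ≤ a := (specNorm_nonneg _).trans hXa
  have hb : 0 ≤ b := (specNorm_nonneg _).trans hXb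
  have hgen : ∀ {x y f : ℝ}, 0 ≤ x → 0 ≤ y → 0 ≤ f → x ≤ a → y ≤ b → f ≤ e →
      (x ^ 2 + x * y) * f ≤ (a ^ 2 + a * b) * e := by
    intro x y f hx hy hf hxa hyb hfe
    gcongr
  have dX : frobNorm (X - X₁) ≤ (a ^ 2 + a * b) * e :=
    (frobNorm_leftInverse_sub_le hX hXt hX₁ hXt₁).trans
      (hgen (specNorm_nonneg _) (specNorm_nonneg _) (frobNorm_nonneg _) hXa hXb hO)
  have dY : frobNorm (Y - Y₁) ≤ (a ^ 2 + a * b) * e :=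
    (frobNorm_leftInverse_sub_le hY hYt hY₁ hYt₁).trans
      (hgen (specNorm_nonneg _) (specNorm_nonneg _) (frobNorm_nonneg _) hYa hYb hQ)
  have hE : 0 ≤ (a ^ 2 + a * b) * e := (frobNorm_nonneg _).trans dX
  -- Telescoping, changing one factor at a time. The factor `√n` appears only in the middle term,
  -- where no factor is already measured in the Frobenius norm.
  have key : X * H * Yᵀ - X₁ * H₁ * Y₁ᵀ =
      (X - X₁) * (H * Yᵀ) + X₁ * ((H - H₁) * Yᵀ) + X₁ * (H₁ * (Y - Y₁)ᵀ) := by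
    simp only [Matrix.sub_mul, Matrix.mul_sub, Matrix.transpose_sub, Matrix.mul_assoc]
    abel
  have t1 : frobNorm ((X - X₁) * (H * Yᵀ)) ≤ (a ^ 2 + a * b) * e * (specNorm H * a) := by
    refine (frobNorm_mul_le_right _ _).trans (mul_le_mul dX ?_ (specNorm_nonneg _) hE)
    refine (specNorm_mul_le _ _).trans ?_
    rw [specNorm_transpose]
    exact mul_le_mul_of_nonneg_left hYa (specNorm_nonneg _)
  have t2 : frobNorm (X₁ * ((H - H₁) * Yᵀ)) ≤ b * (specNorm (H - H₁) * (√n * a)) := by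
    refine (frobNorm_mul_le_left _ _).trans (mul_le_mul hXb ?_ (frobNorm_nonneg _) hb)
    refine (frobNorm_mul_le_left _ _).trans
      (mul_le_mul_of_nonneg_left ?_ (specNorm_nonneg _))
    refine (frobNorm_le_sqrt_mul_specNorm _).trans ?_
    rw [specNorm_transpose]
    exact mul_le_mul_of_nonneg_left hYa (Real.sqrt_nonneg _)
  have t3 : frobNorm (X₁ * (H₁ * (Y - Y₁)ᵀ)) ≤
      b * (specNorm H₁ * ((a ^ 2 + a * b) * e)) := by
    refine (frobNorm_mul_le_left _ _).trans (mul_le_mul hXb ?_ (frobNorm_nonneg _) hb)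
    refine (frobNorm_mul_le_left _ _).trans
      (mul_le_mul_of_nonneg_left ?_ (specNorm_nonneg _))
    rwa [frobNorm_transpose]
  rw [key]
  refine (frobNorm_add_le _ _).trans ((add_le_add ((frobNorm_add_le _ _).trans
    (add_le_add t1 t2)) t3).trans (le_of_eq ?_))
  ring

end StateMatrix

/-! ### The main theorem. -/

theorem mainTheorem4 {n m p T₁ T₂ : ℕ} (hn : 0 < n) [NeZero T₁] [NeZero T₂]
    (A : Matrix (Fin n) (Fin n) ℝ) (B : Matrix (Fin n) (Fin p) ℝ)
    (C : Matrix (Fin m) (Fin n) ℝ) (D : Matrix (Fin m) (Fin p) ℝ)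
    (hobs : IsObservable C A) (hctr : IsControllable A B)
    (G Ghat : Matrix (Fin m) (Fin (T₁ + T₂ + 1) × Fin p) ℝ)
    (hG : G = markovMatrix (T₁ + T₂ + 1) A B C D)
    (R : HoKalmanRun n T₁ T₂ G) (Rhat : HoKalmanRun n T₁ T₂ Ghat)
    (hpos : 0 < nthSingularValue n R.L)
    (hpert : specNorm (R.L - Rhat.L) ≤ nthSingularValue n R.L / 2) :
    ∃ W ∈ Matrix.orthogonalGroup (Fin n) ℝ,
      (frobNorm (R.C - Rhat.C * W) ≤ frobNorm (R.O - Rhat.O * W) ∧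
        frobNorm (R.O - Rhat.O * W) ≤ √(5 * n * specNorm (R.L - Rhat.L))) ∧
      (frobNorm (R.B - Wᵀ * Rhat.B) ≤ frobNorm (R.Q - Wᵀ * Rhat.Q) ∧
        frobNorm (R.Q - Wᵀ * Rhat.Q) ≤ √(5 * n * specNorm (R.L - Rhat.L))) ∧
      frobNorm (R.A - Wᵀ * Rhat.A * W) ≤
        14 * √n / nthSingularValue n R.L *
          (√(specNorm (R.L - Rhat.L) / nthSingularValue n R.L) *
              (specNorm (hankelPlus T₁ T₂ G) +
                specNorm (hankelPlus T₁ T₂ G - hankelPlus T₁ T₂ Ghat)) +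
            specNorm (hankelPlus T₁ T₂ G - hankelPlus T₁ T₂ Ghat)) := by
  obtain ⟨K, hK, hKL⟩ := exists_orthonormal_nthSingularValue_le hn R.L hpos
  set σ := nthSingularValue n R.L
  set δ := specNorm (R.L - Rhat.L)
  set H := hankelPlus T₁ T₂ G
  set H₁ := hankelPlus T₁ T₂ Ghat
  have hδ : 0 ≤ δ := specNorm_nonneg _
  have hs : ∀ i, σ ≤ R.s i := R.isSVD.le_of_forall_mulVec hK hKL
  -- The subspace `K` on which `L` is bounded below by `σ` serves for `L̂` as well, at the cost of
  -- `δ ≤ σ/2`.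
  have hs₁ : ∀ i, σ / 2 ≤ Rhat.s i := Rhat.isSVD.le_of_forall_mulVec hK
    (forall_mulVec_of_specNorm_sub_le hK (by positivity) (by linarith) hKL)
  obtain ⟨W, hW, hbound⟩ := R.isSVD.exists_orthogonal_frobNorm_sub_le Rhat.isSVD hs
  change σ * (frobNorm (R.O - Rhat.O * W) ^ 2 + frobNorm (R.Q - Wᵀ * Rhat.Q) ^ 2) ≤ _ at hbound
  have hWW : W * Wᵀ = 1 := (Matrix.mem_orthogonalGroup_iff _ _).1 hW
  have hWW' : Wᵀ * W = 1 := mul_eq_one_comm.1 hWW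
  have hsum : frobNorm (R.O - Rhat.O * W) ^ 2 + frobNorm (R.Q - Wᵀ * Rhat.Q) ^ 2 ≤
      5 / 2 * (n * δ) := by
    refine le_of_mul_le_mul_left (hbound.trans ?_) hpos
    have : n * δ * δ ≤ n * δ * (σ / 2) := mul_le_mul_of_nonneg_left hpert (by positivity)
    nlinarith
  have hnδ : 0 ≤ n * δ := by positivity
  have hO : frobNorm (R.O - Rhat.O * W) ^ 2 ≤ 5 / 2 * (n * δ) :=
    (le_add_of_nonneg_right (sq_nonneg _)).trans hsum
  have hQ : frobNorm (R.Q - Wᵀ * Rhat.Q) ^ 2 ≤ 5 / 2 * (n * δ) :=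
    (le_add_of_nonneg_left (sq_nonneg _)).trans hsum
  refine ⟨W, hW, ⟨?_, ?_⟩, ⟨?_, ?_⟩, ?_⟩
  · exact frobNorm_submatrix_le (R.O - Rhat.O * W) (Prod.mk_right_injective _)
      Function.injective_id
  · exact Real.le_sqrt_of_sq_le (hO.trans (by linarith))
  · exact frobNorm_submatrix_le (R.Q - Wᵀ * Rhat.Q) Function.injective_id
      (Prod.mk_right_injective _)
  · exact Real.le_sqrt_of_sq_le (hQ.trans (by linarith))
  have hr : 0 < √σ := Real.sqrt_pos.2 hpos
  have hrr : √σ ^ 2 = σ := Real.sq_sqrt hpos.le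
  have ha : 0 < (√σ)⁻¹ := inv_pos.2 hr
  -- `3/2` is a rational upper bound for `√2`, which comes from `(σ/2)^(-1/2)`.
  have hb : 0 < 3 / 2 * (√σ)⁻¹ := by positivity
  have ha' : ∀ i, 1 ≤ (√σ)⁻¹ ^ 2 * R.s i := fun i => by
    rw [inv_pow, hrr, ← div_eq_inv_mul, one_le_div hpos]
    exact hs i
  have hb' : ∀ i, 1 ≤ (3 / 2 * (√σ)⁻¹) ^ 2 * Rhat.s i := fun i => by
    rw [mul_pow, inv_pow, hrr, mul_assoc, ← div_eq_inv_mul, ← mul_div_assoc, one_le_div hpos]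
    linarith [hs₁ i]
  -- `Q` is transposed so that it has full column rank, like `O`, and the same lemmas serve both.
  have qT : R.Qᵀ = R.V * Matrix.diagonal fun i => √(R.s i) := by
    simp [HoKalmanRun.Q, Matrix.transpose_mul]
  have qT₁ : Rhat.Qᵀ = Rhat.V * Matrix.diagonal fun i => √(Rhat.s i) := by
    simp [HoKalmanRun.Q, Matrix.transpose_mul]
  obtain ⟨o1, o2⟩ := pinv_mul_diagonal_sqrt R.isSVD.left_orthonormal ha ha'
  obtain ⟨q1, q2⟩ := pinv_mul_diagonal_sqrt R.isSVD.right_orthonormal ha ha'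
  obtain ⟨o3, o4⟩ := pinv_mul_diagonal_sqrt Rhat.isSVD.left_orthonormal hb hb'
  obtain ⟨q3, q4⟩ := pinv_mul_diagonal_sqrt Rhat.isSVD.right_orthonormal hb hb'
  rw [← qT] at q1 q2
  rw [← qT₁] at q3 q4
  change pinv R.O * R.O = 1 at o1
  change specNorm (pinv R.O) ≤ _ at o2
  change pinv Rhat.O * Rhat.O = 1 at o3
  change specNorm (pinv Rhat.O) ≤ _ at o4
  -- `Wᵀ M†` is the pseudo-inverse of `MW`: the rotation cancels inside the product and leaves the
  -- spectral bound intact.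
  have rotate : ∀ {ι : Type} [Fintype ι] [DecidableEq ι] {M : Matrix ι (Fin n) ℝ},
      pinv M * M = 1 → specNorm (pinv M) ≤ 3 / 2 * (√σ)⁻¹ →
      Wᵀ * pinv M * (M * W) = 1 ∧ (M * W * (Wᵀ * pinv M))ᵀ = M * W * (Wᵀ * pinv M) ∧
        specNorm (Wᵀ * pinv M) ≤ 3 / 2 * (√σ)⁻¹ := by
    intro ι _ _ M h1 h2
    refine ⟨?_, ?_, ?_⟩
    · rw [Matrix.mul_assoc, ← Matrix.mul_assoc (pinv M), h1, Matrix.one_mul, hWW']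
    · rw [Matrix.mul_assoc, ← Matrix.mul_assoc W, hWW, Matrix.one_mul]
      exact (isMoorePenrose_pinv M).symm_left
    · refine (specNorm_mul_le _ _).trans ?_
      rw [specNorm_transpose]
      exact (mul_le_mul (specNorm_le_one_of_transpose_mul_self_eq_one hWW') h2
        (specNorm_nonneg _) zero_le_one).trans (one_mul _).le
  obtain ⟨o5, o6, o7⟩ := rotate o3 o4
  obtain ⟨q5, q6, q7⟩ := rotate q3 q4
  -- `8/5` is a rational upper bound for `√(5/2)`.
  have hsq : ∀ {x : ℝ}, 0 ≤ x → x ^ 2 ≤ 5 / 2 * (n * δ) → x ≤ 8 / 5 * (√n * √δ) := by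
    intro x hx hx2
    refine le_of_sq_le_sq ?_ (by positivity)
    rw [mul_pow, mul_pow, Real.sq_sqrt (Nat.cast_nonneg n), Real.sq_sqrt hδ]
    linarith
  have hQt : frobNorm (R.Qᵀ - Rhat.Qᵀ * W) ≤ 8 / 5 * (√n * √δ) := by
    have e : R.Qᵀ - Rhat.Qᵀ * W = (R.Q - Wᵀ * Rhat.Q)ᵀ := by simp [Matrix.transpose_mul]
    rw [e, frobNorm_transpose]
    exact hsq (frobNorm_nonneg _) hQ
  have hmain := frobNorm_mul_mul_sub_le o1 (isMoorePenrose_pinv _).symm_left o5 o6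
    q1 (isMoorePenrose_pinv _).symm_left q5 q6 o2 q2 o7 q7
    (hsq (frobNorm_nonneg _) hO) hQt H H₁
  have eA : R.A = pinv R.O * H * (pinv R.Qᵀ)ᵀ := by
    rw [pinv_transpose, Matrix.transpose_transpose]
    rfl
  have eA₁ : Wᵀ * Rhat.A * W = Wᵀ * pinv Rhat.O * H₁ * (Wᵀ * pinv Rhat.Qᵀ)ᵀ := by
    rw [Matrix.transpose_mul, pinv_transpose, Matrix.transpose_transpose,
      Matrix.transpose_transpose]
    simp only [HoKalmanRun.A, Matrix.mul_assoc, H₁]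
  rw [eA, eA₁]
  refine hmain.trans ?_
  have hH₁ : specNorm H₁ ≤ specNorm H + specNorm (H - H₁) := specNorm_le_add_specNorm_sub H H₁
  have hH0 : 0 ≤ specNorm (H - H₁) := specNorm_nonneg _
  have hH00 : 0 ≤ specNorm H := specNorm_nonneg _
  rw [Real.sqrt_div hδ]
  have hi : (√σ)⁻¹ ^ 2 = σ⁻¹ := by rw [inv_pow, hrr]
  -- `(1 + 3/2) · 8/5 = 4`, and `4 · 3/2 = 6`.
  have e1 : ((√σ)⁻¹ ^ 2 + (√σ)⁻¹ * (3 / 2 * (√σ)⁻¹)) * (8 / 5 * (√n * √δ)) *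
        ((√σ)⁻¹ * specNorm H + 3 / 2 * (√σ)⁻¹ * specNorm H₁) +
        √n * ((√σ)⁻¹ * (3 / 2 * (√σ)⁻¹)) * specNorm (H - H₁) =
      √n / σ * (√δ / √σ * (4 * specNorm H + 6 * specNorm H₁) + 3 / 2 * specNorm (H - H₁)) := by
    rw [div_eq_mul_inv √n, div_eq_mul_inv √δ, ← hi]
    ring
  have e2 : 14 * √n / σ = √n / σ * 14 := by ring
  rw [e1, e2, mul_assoc]
  refine mul_le_mul_of_nonneg_left ?_ (by positivity)
  have hw : 0 ≤ √δ / √σ := by positivity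
  -- Bounding `‖Ĥ⁺‖` by `‖H⁺‖ + ‖H⁺ - Ĥ⁺‖` gives total weight `4 + 6 = 10`, within the allowed `14`.
  have := mul_le_mul_of_nonneg_left
    (show 4 * specNorm H + 6 * specNorm H₁ ≤ 14 * (specNorm H + specNorm (H - H₁)) by linarith) hw
  linarith
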